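/- Let $n\ge 1$, let $\Omega\subset\mathbb{R}^n$ be a bounded domain (non-empty, open, connected), and let $G$ be an N-function: $G(t)=\int_0^t g(s)\,ds$ for $t\in\mathbb{R}$, where $g:\mathbb{R}\to\mathbb{R}$ is odd, continuous and non-decreasing, $g(0)=0$, $g(t)>0$ for $t>0$, and $g(t)\to\infty$ as $t\to\infty$. Assume that there are constants $p^-,p^+$ with $$1<p^-\le \frac{t\,g(t)}{G(t)}\le p^+<\infty\qquad\text{for all } t>0.$$ Let $L^G(\Omega)$ be the Orlicz space of measurable $u:\Omega\to\mathbb{R}$ with $\int_\Omega G(u)\,dx<\infty$, with the Luxemburg norm $\|u\|_G=\inf\{k>0:\int_\Omega G(u/k)\,dx\le 1\}$. Let $W^{2,G}(\Omega)$ be the space of all $u\in L^G(\Omega)$ whose distributional derivatives $D^\alpha u$, $|\alpha|\le 2$, belong to $L^G(\Omega)$, with the norm $\sum_{|\alpha|\le 2}\|D^\alpha u\|_G$, and let $W^{2,G}_0(\Omega)$ be the closure of $C_0^\infty(\Omega)$ in $W^{2,G}(\Omega)$. For $r>0$ put $$c_r=\inf\Big\{\int_\Omega G(\Delta v)\,dx:\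 v\in W^{2,G}_0(\Omega),\ \int_\Omega G(v)\,dx=r\Big\}.$$ **Theorem.** Let $r>0$ and let $u_r$ be a minimizer for $c_r$, that is, $u_r\in W^{2,G}_0(\Omega)$, $\int_\Omega G(u_r)\,dx=r$ and $\int_\Omega G(\Delta u_r)\,dx=c_r$. Then there is $\lambda_r>0$ such that $u_r$ is a weak solution in $\Omega$ of $$\Delta_g^2u_r=\lambda_r\,\frac{g(|u_r|)}{|u_r|}\,u_r,\qquad\text{where } \Delta_g^2 u=\Delta\Big(\frac{g(|\Delta u|)}{|\Delta u|}\,\Delta u\Big),$$ that is, for every $v\in W^{2,G}_0(\Omega)$ both integrands below are integrable on $\Omega$ and $$\int_\Omega \frac{g(|\Delta u_r|)}{|\Delta u_r|}\,\Delta u_r\,\Delta v\,dx=\lambda_r\int_\Omega\frac{g(|u_r|)}{|u_r|}\,u_r\,v\,dx,$$ where $\frac{g(|s|)}{|s|}s$ is read as $0$ at $s=0$. -/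

import Mathlib

open MeasureTheory Set Filter
open scoped ContDiff

noncomputable section

namespace BiharmonicOrlicz

/-- `G` is an N-function with density `g`: `g` is odd, continuous and non-decreasing, `g 0 = 0`,
`g t > 0` for `t > 0`, `g t → ∞` as `t → ∞`, and `G t = ∫₀ᵗ g`. -/
structure IsNFunction (G g : ℝ → ℝ) : Prop where
  odd : ∀ t, g (-t) = -g t
  continuous : Continuous g
  mono : Monotone g
  zero : g 0 = 0
  pos : ∀ t, 0 < t → 0 < g t
  tendsto : Tendsto g atTop atTop
  eq_integral : ∀ t, G t = ∫ s in (0 : ℝ)..t, g s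

/-- The growth condition `1 < p⁻ ≤ t g(t) / G(t) ≤ p⁺ < ∞` for all `t > 0`. -/
def GrowthCondition (G g : ℝ → ℝ) (pm pp : ℝ) : Prop :=
  1 < pm ∧ ∀ t, 0 < t → pm ≤ t * g t / G t ∧ t * g t / G t ≤ pp

variable {n : ℕ}

/-- Test functions, `φ ∈ C₀^∞(Ω)`: smooth with compact support contained in `Ω`. -/
def IsTestFunction (Ω : Set (EuclideanSpace ℝ (Fin n))) (φ : EuclideanSpace ℝ (Fin n) → ℝ) :
    Prop :=
  ContDiff ℝ ∞ φ ∧ HasCompactSupport φ ∧ tsupport φ ⊆ Ω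

/-- The classical partial derivative `∂ᵢ f`. -/
def partialDeriv (i : Fin n) (f : EuclideanSpace ℝ (Fin n) → ℝ) :
    EuclideanSpace ℝ (Fin n) → ℝ :=
  fun x => fderiv ℝ f x (EuclideanSpace.single i 1)

/-- Iterated classical partial derivatives: `[i₁, …, iₖ]` gives `∂_{i₁} ⋯ ∂_{iₖ} f`, and `[]`
gives `f`. -/
def partialDerivs (l : List (Fin n)) (f : EuclideanSpace ℝ (Fin n) → ℝ) :
    EuclideanSpace ℝ (Fin n) → ℝ :=
  l.foldr partialDeriv f

/-- `w` is a distributional derivative `∂_{i₁} ⋯ ∂_{iₖ} u` on `Ω`, where `l = [i₁, …, iₖ]`. -/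
def HasWeakDeriv (Ω : Set (EuclideanSpace ℝ (Fin n))) (l : List (Fin n))
    (u w : EuclideanSpace ℝ (Fin n) → ℝ) : Prop :=
  LocallyIntegrableOn u Ω ∧ LocallyIntegrableOn w Ω ∧
    ∀ φ : EuclideanSpace ℝ (Fin n) → ℝ, IsTestFunction Ω φ →
      ∫ x in Ω, u x * partialDerivs l φ x = (-1) ^ l.length * ∫ x in Ω, w x * φ x

open Classical in
/-- A representative of the distributional derivative `∂_{i₁} ⋯ ∂_{iₖ} u` on `Ω` (unique up to
a null set when it exists as a locally integrable function; `0` when there is none). -/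
def weakDeriv (Ω : Set (EuclideanSpace ℝ (Fin n))) (l : List (Fin n))
    (u : EuclideanSpace ℝ (Fin n) → ℝ) : EuclideanSpace ℝ (Fin n) → ℝ :=
  if h : ∃ w, HasWeakDeriv Ω l u w then h.choose else 0

/-- The distributional Laplacian `Δu = ∑ᵢ ∂ᵢ∂ᵢ u`. -/
def weakLaplacian (Ω : Set (EuclideanSpace ℝ (Fin n))) (u : EuclideanSpace ℝ (Fin n) → ℝ) :
    EuclideanSpace ℝ (Fin n) → ℝ :=
  fun x => ∑ i, weakDeriv Ω [i, i] u x

/-- The Orlicz class `L^G(Ω)`. -/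
def MemOrlicz (Ω : Set (EuclideanSpace ℝ (Fin n))) (G : ℝ → ℝ)
    (u : EuclideanSpace ℝ (Fin n) → ℝ) : Prop :=
  AEStronglyMeasurable u (volume.restrict Ω) ∧
    Integrable (fun x => G (u x)) (volume.restrict Ω)

/-- The modular `∫_Ω G(u) dx`. -/
def modular (Ω : Set (EuclideanSpace ℝ (Fin n))) (G : ℝ → ℝ)
    (u : EuclideanSpace ℝ (Fin n) → ℝ) : ℝ :=
  ∫ x in Ω, G (u x)

/-- The Luxemburg norm `inf {k > 0 : ∫_Ω G(u / k) dx ≤ 1}`. The integral is taken in `[0, ∞]`, so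
that a divergent integral is never `≤ 1`. -/
def luxemburgNorm (Ω : Set (EuclideanSpace ℝ (Fin n))) (G : ℝ → ℝ)
    (u : EuclideanSpace ℝ (Fin n) → ℝ) : ℝ :=
  sInf {k : ℝ | 0 < k ∧ ∫⁻ x in Ω, ENNReal.ofReal (G (u x / k)) ≤ 1}

/-- The Orlicz-Sobolev space `W^{2,G}(Ω)`: all distributional derivatives of order at most two
exist as functions in `L^G(Ω)`. -/
def MemW2 (Ω : Set (EuclideanSpace ℝ (Fin n))) (G : ℝ → ℝ)
    (u : EuclideanSpace ℝ (Fin n) → ℝ) : Prop :=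
  MemOrlicz Ω G u ∧
    ∀ l : List (Fin n), l.length ≤ 2 → ∃ w, HasWeakDeriv Ω l u w ∧ MemOrlicz Ω G w

/-- The norm `∑_{|α| ≤ 2} ‖D^α u‖_G` of `W^{2,G}(Ω)`; the multi-indices of order two are the
pairs `i ≤ j`. -/
def normW2 (Ω : Set (EuclideanSpace ℝ (Fin n))) (G : ℝ → ℝ)
    (u : EuclideanSpace ℝ (Fin n) → ℝ) : ℝ :=
  luxemburgNorm Ω G u + ∑ i, luxemburgNorm Ω G (weakDeriv Ω [i] u) +
    ∑ i, ∑ j ∈ Finset.Ici i, luxemburgNorm Ω G (weakDeriv Ω [i, j] u)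

/-- `W₀^{2,G}(Ω)`: the closure of `C₀^∞(Ω)` in `W^{2,G}(Ω)`. -/
def MemW20 (Ω : Set (EuclideanSpace ℝ (Fin n))) (G : ℝ → ℝ)
    (u : EuclideanSpace ℝ (Fin n) → ℝ) : Prop :=
  MemW2 Ω G u ∧ ∀ ε : ℝ, 0 < ε →
    ∃ φ : EuclideanSpace ℝ (Fin n) → ℝ, IsTestFunction Ω φ ∧ normW2 Ω G (u - φ) < ε

/-- `c_r = inf {∫_Ω G(Δv) dx : v ∈ W₀^{2,G}(Ω), ∫_Ω G(v) dx = r}`. -/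
def constrainedInf (Ω : Set (EuclideanSpace ℝ (Fin n))) (G : ℝ → ℝ) (r : ℝ) : ℝ :=
  sInf {c : ℝ | ∃ v, MemW20 Ω G v ∧ modular Ω G v = r ∧ c = modular Ω G (weakLaplacian Ω v)}

/-- `u` solves the constrained minimization problem defining `c_r`. -/
def IsConstrainedMinimizer (Ω : Set (EuclideanSpace ℝ (Fin n))) (G : ℝ → ℝ) (r : ℝ)
    (u : EuclideanSpace ℝ (Fin n) → ℝ) : Prop :=
  MemW20 Ω G u ∧ modular Ω G u = r ∧
    modular Ω G (weakLaplacian Ω u) = constrainedInf Ω G r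

/-- The function `s ↦ (g(|s|) / |s|) s`, with value `0` at `s = 0`. -/
def signedDensity (g : ℝ → ℝ) (s : ℝ) : ℝ := g |s| / |s| * s

/-- `u ∈ W₀^{2,G}(Ω)` is a weak solution of `Δ_g² u = f(x, u)` in `Ω`. -/
def IsWeakSolution (Ω : Set (EuclideanSpace ℝ (Fin n))) (G g : ℝ → ℝ)
    (f : EuclideanSpace ℝ (Fin n) → ℝ → ℝ) (u : EuclideanSpace ℝ (Fin n) → ℝ) : Prop :=
  MemW20 Ω G u ∧ ∀ v : EuclideanSpace ℝ (Fin n) → ℝ, MemW20 Ω G v →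
    Integrable (fun x => signedDensity g (weakLaplacian Ω u x) * weakLaplacian Ω v x)
      (volume.restrict Ω) ∧
    Integrable (fun x => f x (u x) * v x) (volume.restrict Ω) ∧
    ∫ x in Ω, signedDensity g (weakLaplacian Ω u x) * weakLaplacian Ω v x =
      ∫ x in Ω, f x (u x) * v x

end BiharmonicOrlicz

end

/-! For the minimizer u put A(v) = ∫ g(Δu) Δv and B(v) = ∫ g(u) v. Both are finite and linear on
W₀^{2,G}(Ω), by a Young-type inequality that comes from the upper growth bound.

If B(v) > 0, the tangent inequality for the convex function G gives ∫ G(u + εv) ≥ r + εB(v) > r for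
every ε > 0. Scaling u + εv down by a factor in [0, 1] restores the constraint without raising the
energy, so u + εv cannot have less energy than u. Were A(v) < 0, the energy would drop for small ε.
Hence B(v) > 0 implies A(v) ≥ 0 (`IsConstrainedMinimizer.integral_nonneg`). When A(u) and B(u) are
positive, linearity makes A and B proportional: testing with v + su for s slightly above -B(v)/B(u)
gives A(v) ≥ (A(u)/B(u)) B(v), and -v gives the reverse. So λ = A(u)/B(u).

Convexity gives B(u) ≥ r > 0. For A(u) > 0 one must exclude Δu = 0
(`MemW20.ae_eq_zero_of_weakLaplacian`). Approximation by test functions on a bounded set lets u be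
integrated by parts against cos(x·ξ) and sin(x·ξ). Then Δu = 0 makes the Fourier transform of u,
extended by zero, vanish for ξ ≠ 0, hence everywhere by continuity, so u = 0, contradicting r > 0.
-/

noncomputable section

namespace BiharmonicOrlicz

/-! ### N-functions: convexity, tangent lines, Young and Δ₂ inequalities -/

section NFunction

variable {G g : ℝ → ℝ} {pm pp : ℝ}

lemma IsNFunction.hasDerivAt (hG : IsNFunction G g) (t : ℝ) : HasDerivAt G (g t) t := by
  have : G = fun t => ∫ s in (0 : ℝ)..t, g s := funext hG.eq_integral
  rw [this]
  exact (hG.continuous.integral_hasStrictDerivAt 0 t).hasDerivAt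

lemma IsNFunction.continuous_G (hG : IsNFunction G g) : Continuous G :=
  continuous_iff_continuousAt.2 fun t => (hG.hasDerivAt t).continuousAt

lemma IsNFunction.G_zero (hG : IsNFunction G g) : G 0 = 0 := by
  rw [hG.eq_integral]; simp

lemma IsNFunction.G_neg (hG : IsNFunction G g) (t : ℝ) : G (-t) = G t := by
  have h := intervalIntegral.integral_comp_neg (a := 0) (b := t) g
  simp only [hG.odd, neg_zero, intervalIntegral.integral_neg] at h
  rw [hG.eq_integral (-t), hG.eq_integral t, intervalIntegral.integral_symm, ← h, neg_neg]

lemma IsNFunction.G_abs (hG : IsNFunction G g) (t : ℝ) : G |t| = G t := by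
  rcases abs_choice t with h | h <;> rw [h]
  exact hG.G_neg t

lemma IsNFunction.convexOn (hG : IsNFunction G g) : ConvexOn ℝ univ G := by
  refine Monotone.convexOn_univ_of_deriv (fun t => (hG.hasDerivAt t).differentiableAt) ?_
  have : deriv G = g := funext fun t => (hG.hasDerivAt t).deriv
  rw [this]; exact hG.mono

lemma IsNFunction.G_combo_le (hG : IsNFunction G g) (x y : ℝ) {a b : ℝ} (ha : 0 ≤ a) (hb : 0 ≤ b)
    (hab : a + b = 1) : G (a * x + b * y) ≤ a * G x + b * G y :=
  hG.convexOn.2 (mem_univ x) (mem_univ y) ha hb hab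

/-- The graph of `G` lies above its tangent lines. -/
lemma IsNFunction.tangent_le (hG : IsNFunction G g) (x y : ℝ) : G x + g x * y ≤ G (x + y) := by
  rcases lt_trichotomy y 0 with h | h | h
  · have := hG.convexOn.slope_le_of_hasDerivAt (x := x + y) (y := x) (mem_univ _) (mem_univ _)
      (by linarith) (hG.hasDerivAt x)
    rw [slope_def_field, div_le_iff₀ (by linarith)] at this
    linarith
  · simp [h]
  · have := hG.convexOn.le_slope_of_hasDerivAt (x := x) (y := x + y) (mem_univ _) (mem_univ _)
      (by linarith) (hG.hasDerivAt x)
    rw [slope_def_field, le_div_iff₀ (by linarith)] at this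
    linarith

lemma IsNFunction.nonneg (hG : IsNFunction G g) (t : ℝ) : 0 ≤ G t := by
  have := hG.tangent_le 0 t
  simpa [hG.G_zero, hG.zero] using this

lemma IsNFunction.g_nonneg (hG : IsNFunction G g) {t : ℝ} (ht : 0 ≤ t) : 0 ≤ g t := by
  rw [← hG.zero]; exact hG.mono ht

lemma IsNFunction.abs_g (hG : IsNFunction G g) (t : ℝ) : |g t| = g |t| := by
  rcases le_total 0 t with h | h
  · rw [abs_of_nonneg h, abs_of_nonneg (hG.g_nonneg h)]
  · have := hG.g_nonneg (neg_nonneg.2 h)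
    rw [abs_of_nonpos h, hG.odd, abs_of_nonpos (by rw [hG.odd] at this; linarith)]

lemma IsNFunction.G_le_of_abs_le (hG : IsNFunction G g) {x y : ℝ} (h : |x| ≤ |y|) :
    G x ≤ G y := by
  have h1 := hG.tangent_le |x| (|y| - |x|)
  have h2 := mul_nonneg (hG.g_nonneg (abs_nonneg x)) (sub_nonneg.2 h)
  rw [add_sub_cancel, hG.G_abs, hG.G_abs] at h1
  linarith

/-- The tangent line at `t`, evaluated at the origin. It yields B(u) ≥ r for the minimizer. -/
lemma IsNFunction.G_le_mul_self (hG : IsNFunction G g) (t : ℝ) : G t ≤ g t * t := by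
  have := hG.tangent_le t (-t)
  rw [add_neg_cancel, hG.G_zero] at this
  linarith

lemma IsNFunction.g_mul_self_nonneg (hG : IsNFunction G g) (t : ℝ) : 0 ≤ g t * t :=
  (hG.nonneg t).trans (hG.G_le_mul_self t)

lemma IsNFunction.eq_zero_of_g_mul_self (hG : IsNFunction G g) {t : ℝ} (h : g t * t = 0) :
    t = 0 := by
  by_contra h0
  have h1 : 0 < g |t| := hG.pos _ (abs_pos.2 h0)
  rw [← hG.abs_g, abs_pos] at h1
  exact mul_ne_zero h1 h0 h

lemma IsNFunction.signedDensity_eq (hG : IsNFunction G g) (s : ℝ) : signedDensity g s = g s := by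
  unfold signedDensity
  rcases lt_trichotomy s 0 with h | h | h
  · rw [abs_of_neg h, hG.odd, neg_div_neg_eq, div_mul_cancel₀ _ h.ne]
  · simp [h, hG.zero]
  · rw [abs_of_pos h, div_mul_cancel₀ _ h.ne']

/-- An N-function grows at least linearly. -/
lemma IsNFunction.abs_le (hG : IsNFunction G g) (t : ℝ) : |t| ≤ 1 + (g 1)⁻¹ * G t := by
  have h1 := hG.pos 1 one_pos
  have h := hG.tangent_le 1 (|t| - 1)
  rw [add_sub_cancel, hG.G_abs] at h
  have h2 : |t| - 1 ≤ (g 1)⁻¹ * G t := by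
    rw [inv_mul_eq_div, le_div_iff₀ h1]
    linarith [hG.nonneg 1]
  linarith

lemma GrowthCondition.pp_pos (h : GrowthCondition G g pm pp) : 0 < pp := by
  have := h.2 1 one_pos
  linarith [h.1]

lemma IsNFunction.g_mul_self_le (hG : IsNFunction G g) (h : GrowthCondition G g pm pp) (t : ℝ) :
    g t * t ≤ pp * G t := by
  have key : ∀ t, 0 < t → g t * t ≤ pp * G t := by
    intro t ht
    obtain ⟨h1, h2⟩ := h.2 t ht
    rcases (hG.nonneg t).eq_or_lt with h0 | h0
    -- Division by zero makes the quotient `0` here, which `1 < pm` excludes.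
    · rw [← h0, div_zero] at h1
      linarith [h.1]
    · rw [div_le_iff₀ h0] at h2
      linarith
  rcases lt_trichotomy t 0 with ht | ht | ht
  · have := key (-t) (by linarith)
    rw [hG.odd, hG.G_neg] at this
    linarith
  · simp [ht, hG.G_zero]
  · exact key t ht

/-- A Young-type inequality. -/
lemma IsNFunction.abs_g_mul_le (hG : IsNFunction G g) (h : GrowthCondition G g pm pp) (x y : ℝ) :
    |g x * y| ≤ pp * (G x + G y) := by
  have hp := h.pp_pos
  rw [abs_mul, hG.abs_g]
  -- With m the larger of |x| and |y|, monotonicity bounds the product by g(m) m ≤ `pp` G(m).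
  rcases le_total |y| |x| with hxy | hxy
  · have h1 := hG.g_mul_self_le h |x|
    rw [hG.G_abs] at h1
    have h2 := mul_le_mul_of_nonneg_left hxy (hG.g_nonneg (abs_nonneg x))
    nlinarith [mul_nonneg hp.le (hG.nonneg y)]
  · have h1 := hG.g_mul_self_le h |y|
    rw [hG.G_abs] at h1
    have h2 := mul_le_mul_of_nonneg_right (hG.mono hxy) (abs_nonneg y)
    nlinarith [mul_nonneg hp.le (hG.nonneg x)]

/-- The `Δ₂` condition, in the form of polynomial growth. -/
lemma IsNFunction.exists_G_mul_le (hG : IsNFunction G g) (h : GrowthCondition G g pm pp) (c : ℝ) :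
    ∃ K : ℝ, 0 ≤ K ∧ ∀ t, G (c * t) ≤ K * G t := by
  obtain ⟨N, hN⟩ := exists_nat_ge pp
  set s := max 1 |c| with hs
  have hs1 : 1 ≤ s := le_max_left _ _
  -- The numerator of the derivative is t^(N-1) (t g(t) - N G(t)) up to a positive power of t, and
  -- it is nonpositive because N ≥ `pp`. Comparing the values at |t| and s|t| with s ≥ 1 then gives
  -- the factor s^N.
  have hanti : AntitoneOn (fun t => G t / t ^ N) (Ioi 0) := by
    have hd : ∀ t ∈ Ioi (0 : ℝ), HasDerivAt (fun t => G t / t ^ N)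
        ((g t * t ^ N - G t * (N * t ^ (N - 1))) / (t ^ N) ^ 2) t := fun t ht =>
      (hG.hasDerivAt t).fun_div (hasDerivAt_pow N t) (pow_ne_zero _ (ne_of_gt ht))
    refine antitoneOn_of_deriv_nonpos (convex_Ioi 0)
      (fun t ht => (hd t ht).continuousAt.continuousWithinAt)
      (fun t ht => (hd t (by simpa using ht)).differentiableAt.differentiableWithinAt) ?_
    intro t ht
    rw [interior_Ioi] at ht
    have ht' : 0 < t := ht
    rw [(hd t ht).deriv]
    refine div_nonpos_of_nonpos_of_nonneg ?_ (by positivity)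
    have hN0 : N ≠ 0 := by
      rintro rfl
      have := h.pp_pos
      simp at hN; linarith
    obtain ⟨M, rfl⟩ := Nat.exists_eq_succ_of_ne_zero hN0
    have h1 := hG.g_mul_self_le h t
    have h2 := mul_le_mul_of_nonneg_right hN (hG.nonneg t)
    have h3 : 0 ≤ t ^ M := by positivity
    simp only [Nat.succ_eq_add_one, Nat.add_sub_cancel, pow_succ] at h2 ⊢
    nlinarith
  refine ⟨s ^ N, by positivity, fun t => ?_⟩
  rcases eq_or_ne t 0 with rfl | ht
  · simp [hG.G_zero]
  · have ht' : 0 < |t| := abs_pos.2 ht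
    have h1 : G (c * t) ≤ G (s * |t|) := by
      apply hG.G_le_of_abs_le
      rw [abs_mul, abs_mul, abs_abs, abs_of_nonneg (by linarith : 0 ≤ s)]
      exact mul_le_mul_of_nonneg_right (le_max_right _ _) (abs_nonneg _)
    have h2 := hanti (a := |t|) (b := s * |t|) ht' (by simp only [mem_Ioi]; positivity)
      (le_mul_of_one_le_left ht'.le hs1)
    simp only at h2
    rw [div_le_div_iff₀ (by positivity) (by positivity), hG.G_abs, mul_pow] at h2
    have h3 : G (s * |t|) ≤ s ^ N * G t := by
      have : 0 < |t| ^ N := by positivity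
      refine le_of_mul_le_mul_right (h2.trans_eq (by ring)) this
    exact h1.trans h3

/-- The sum is at most twice the larger of |x| and |y|, so one of the two terms already suffices. -/
lemma IsNFunction.G_add_le (hG : IsNFunction G g) (x y : ℝ) :
    G (x + y) ≤ G (2 * x) + G (2 * y) := by
  rcases le_total |x| |y| with h | h
  · refine (hG.G_le_of_abs_le (y := 2 * y) ?_).trans (le_add_of_nonneg_left (hG.nonneg _))
    rw [abs_mul, abs_two]; linarith [abs_add_le x y]
  · refine (hG.G_le_of_abs_le (y := 2 * x) ?_).trans (le_add_of_nonneg_right (hG.nonneg _))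
    rw [abs_mul, abs_two]; linarith [abs_add_le x y]

end NFunction

/-! ### Orlicz classes and the Luxemburg norm -/

section Orlicz

variable {n : ℕ} {Ω : Set (EuclideanSpace ℝ (Fin n))} {G g : ℝ → ℝ} {pm pp : ℝ}
  {u v : EuclideanSpace ℝ (Fin n) → ℝ}

lemma MemOrlicz.congr (hu : MemOrlicz Ω G u) (h : u =ᵐ[volume.restrict Ω] v) :
    MemOrlicz Ω G v :=
  ⟨hu.1.congr h, hu.2.congr (h.fun_comp G)⟩

lemma modular_congr (h : u =ᵐ[volume.restrict Ω] v) : modular Ω G u = modular Ω G v :=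
  integral_congr_ae (h.fun_comp G)

lemma luxemburgNorm_congr (h : u =ᵐ[volume.restrict Ω] v) :
    luxemburgNorm Ω G u = luxemburgNorm Ω G v := by
  unfold luxemburgNorm
  congr 1; ext k
  have := lintegral_congr_ae (h.fun_comp fun s => ENNReal.ofReal (G (s / k)))
  simp only [Function.comp_def] at this
  rw [mem_ofPred_eq, mem_ofPred_eq, this]

lemma MemOrlicz.const_mul (hG : IsNFunction G g) (h : GrowthCondition G g pm pp)
    (hu : MemOrlicz Ω G u) (c : ℝ) : MemOrlicz Ω G (fun x => c * u x) := by
  obtain ⟨K, -, hK⟩ := hG.exists_G_mul_le h c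
  have hm : AEStronglyMeasurable (fun x => c * u x) (volume.restrict Ω) := hu.1.const_mul c
  refine ⟨hm, (hu.2.const_mul K).mono' (hG.continuous_G.comp_aestronglyMeasurable hm) ?_⟩
  refine ae_of_all _ fun x => ?_
  rw [Real.norm_of_nonneg (hG.nonneg _)]
  exact hK _

lemma MemOrlicz.add (hG : IsNFunction G g) (h : GrowthCondition G g pm pp)
    (hu : MemOrlicz Ω G u) (hv : MemOrlicz Ω G v) : MemOrlicz Ω G (fun x => u x + v x) := by
  have hm : AEStronglyMeasurable (fun x => u x + v x) (volume.restrict Ω) := hu.1.add hv.1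
  refine ⟨hm, ((hu.const_mul hG h 2).2.add (hv.const_mul hG h 2).2).mono'
    (hG.continuous_G.comp_aestronglyMeasurable hm) ?_⟩
  refine ae_of_all _ fun x => ?_
  rw [Real.norm_of_nonneg (hG.nonneg _)]
  exact hG.G_add_le _ _

lemma memOrlicz_zero (hG : IsNFunction G g) : MemOrlicz Ω G (fun _ => 0) :=
  ⟨aestronglyMeasurable_const, by simp [hG.G_zero]⟩

lemma MemOrlicz.sum (hG : IsNFunction G g) (h : GrowthCondition G g pm pp) {ι : Type*}
    (s : Finset ι) {f : ι → EuclideanSpace ℝ (Fin n) → ℝ} (hf : ∀ i ∈ s, MemOrlicz Ω G (f i)) :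
    MemOrlicz Ω G (fun x => ∑ i ∈ s, f i x) := by
  classical
  induction s using Finset.induction_on with
  | empty => simpa using memOrlicz_zero hG
  | insert a s ha ih =>
    simp only [Finset.sum_insert ha]
    exact (hf a (by simp)).add hG h (ih fun i hi => hf i (by simp [hi]))

lemma MemOrlicz.integrable (hG : IsNFunction G g) (hΩ : Bornology.IsBounded Ω)
    (hu : MemOrlicz Ω G u) : IntegrableOn u Ω := by
  have : IsFiniteMeasure (volume.restrict Ω) := ⟨by simpa using hΩ.measure_lt_top⟩
  exact ((integrable_const (1 : ℝ)).add (hu.2.const_mul (g 1)⁻¹)).mono' hu.1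
    (ae_of_all _ fun _ => hG.abs_le _)

lemma MemOrlicz.integrable_g_mul (hG : IsNFunction G g) (h : GrowthCondition G g pm pp)
    (hu : MemOrlicz Ω G u) (hv : MemOrlicz Ω G v) : IntegrableOn (fun x => g (u x) * v x) Ω :=
  ((hu.2.add hv.2).const_mul pp).mono' ((hG.continuous.comp_aestronglyMeasurable hu.1).mul hv.1)
    (ae_of_all _ fun _ => hG.abs_g_mul_le h _ _)

lemma memOrlicz_of_continuous (hG : IsNFunction G g) (hu : Continuous u)
    (hc : HasCompactSupport u) : MemOrlicz Ω G u :=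
  ⟨hu.aestronglyMeasurable, ((hG.continuous_G.comp hu).integrable_of_hasCompactSupport
    (hc.comp_left hG.G_zero)).integrableOn⟩

lemma luxemburgNorm_nonneg : 0 ≤ luxemburgNorm Ω G u :=
  Real.sInf_nonneg fun _ hk => hk.1.le

lemma luxemburgNorm_le {k : ℝ} (hk : 0 < k)
    (h : ∫⁻ x in Ω, ENNReal.ofReal (G (u x / k)) ≤ 1) : luxemburgNorm Ω G u ≤ k :=
  csInf_le ⟨0, fun _ hk => hk.1.le⟩ ⟨hk, h⟩

/-- The infimum defining the norm is over a nonempty set, so it is not the default value of `sInf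
∅`. By convexity and G(0) = 0, G(t/k) ≤ G(t)/k for k ≥ 1, so k = max(1, ∫ G(u)) is admissible. -/
lemma MemOrlicz.exists_lintegral_le (hG : IsNFunction G g) (hu : MemOrlicz Ω G u) :
    ∃ k : ℝ, 0 < k ∧ ∫⁻ x in Ω, ENNReal.ofReal (G (u x / k)) ≤ 1 := by
  set k := max 1 (∫ x in Ω, G (u x)) with hk
  have hk1 : 1 ≤ k := le_max_left _ _
  have hk0 : 0 < k := by linarith
  refine ⟨k, hk0, ?_⟩
  have hle : ∀ t, G (t / k) ≤ G t / k := by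
    intro t
    have := hG.G_combo_le t 0 (a := 1 / k) (b := 1 - 1 / k)
      (by positivity) (by rw [sub_nonneg, div_le_one hk0]; exact hk1) (by ring)
    simp only [mul_zero, add_zero, hG.G_zero] at this
    rwa [one_div_mul_eq_div, one_div_mul_eq_div] at this
  calc ∫⁻ x in Ω, ENNReal.ofReal (G (u x / k)) ≤ ∫⁻ x in Ω, ENNReal.ofReal (G (u x) / k) :=
        lintegral_mono fun x => ENNReal.ofReal_le_ofReal (hle _)
    _ = ENNReal.ofReal (∫ x in Ω, G (u x) / k) :=
        (ofReal_integral_eq_lintegral_ofReal (hu.2.div_const k)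
          (ae_of_all _ fun x => div_nonneg (hG.nonneg _) hk0.le)).symm
    _ ≤ 1 := by
        rw [integral_div, ENNReal.ofReal_le_one, div_le_one hk0]
        exact le_max_right _ _

lemma MemOrlicz.exists_lt_of_luxemburgNorm_lt (hG : IsNFunction G g) (hu : MemOrlicz Ω G u)
    {ε : ℝ} (hε : luxemburgNorm Ω G u < ε) :
    ∃ k : ℝ, 0 < k ∧ k < ε ∧ ∫⁻ x in Ω, ENNReal.ofReal (G (u x / k)) ≤ 1 := by
  obtain ⟨k, hk, hkε⟩ := exists_lt_of_csInf_lt (hu.exists_lintegral_le hG) hε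
  exact ⟨k, hk.1, hkε, hk.2⟩

lemma MemOrlicz.aemeasurable_div (hG : IsNFunction G g) (hu : MemOrlicz Ω G u) (k : ℝ) :
    AEMeasurable (fun x => ENNReal.ofReal (G (u x / k))) (volume.restrict Ω) :=
  ENNReal.measurable_ofReal.comp_aemeasurable
    (hG.continuous_G.measurable.comp_aemeasurable (hu.1.aemeasurable.div_const k))

/-- The triangle inequality for the Luxemburg norm, with a crude bound on the scalar. -/
lemma luxemburgNorm_add_mul_le (hG : IsNFunction G g) (hu : MemOrlicz Ω G u)
    (hv : MemOrlicz Ω G v) (c : ℝ) :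
    luxemburgNorm Ω G (fun x => u x + c * v x) ≤
      luxemburgNorm Ω G u + (|c| + 1) * luxemburgNorm Ω G v := by
  have hc : 0 < |c| + 1 := by positivity
  have key : ∀ a b : ℝ, luxemburgNorm Ω G u < a → luxemburgNorm Ω G v < b →
      luxemburgNorm Ω G (fun x => u x + c * v x) ≤ a + (|c| + 1) * b := by
    intro a b ha hb
    obtain ⟨k, hk0, hka, hk⟩ := hu.exists_lt_of_luxemburgNorm_lt hG ha
    obtain ⟨l, hl0, hlb, hl⟩ := hv.exists_lt_of_luxemburgNorm_lt hG hb
    -- (u + cv)/m is a convex combination of u/k and cv/((|c| + 1) l). The factor |c| + 1, rather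
    -- than |c|, avoids a separate case c = 0.
    set m := k + (|c| + 1) * l with hm
    have hm0 : 0 < m := by positivity
    have hpt : ∀ s t : ℝ, G ((s + c * t) / m) ≤
        k / m * G (s / k) + ((|c| + 1) * l) / m * G (t / l) := by
      intro s t
      have h1 := hG.G_combo_le (s / k) (c * t / ((|c| + 1) * l))
        (a := k / m) (b := ((|c| + 1) * l) / m) (by positivity) (by positivity)
        (by rw [← add_div, ← hm, div_self hm0.ne'])
      have h2 : k / m * (s / k) + ((|c| + 1) * l) / m * (c * t / ((|c| + 1) * l)) =
          (s + c * t) / m := by field_simp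
      have h3 : G (c * t / ((|c| + 1) * l)) ≤ G (t / l) := by
        apply hG.G_le_of_abs_le
        rw [abs_div, abs_div, abs_mul, abs_mul, abs_of_pos hc, mul_div_mul_comm]
        refine mul_le_of_le_one_left (by positivity) ?_
        rw [div_le_one hc]; linarith
      rw [h2] at h1
      refine h1.trans (add_le_add le_rfl (mul_le_mul_of_nonneg_left h3 (by positivity)))
    refine (luxemburgNorm_le hm0 ?_).trans (by rw [hm]; gcongr)
    calc ∫⁻ x in Ω, ENNReal.ofReal (G ((u x + c * v x) / m))
        ≤ ∫⁻ x in Ω, (ENNReal.ofReal (k / m) * ENNReal.ofReal (G (u x / k)) +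
            ENNReal.ofReal (((|c| + 1) * l) / m) * ENNReal.ofReal (G (v x / l))) := by
          refine lintegral_mono fun x => ?_
          rw [← ENNReal.ofReal_mul (by positivity), ← ENNReal.ofReal_mul (by positivity),
            ← ENNReal.ofReal_add (mul_nonneg (by positivity) (hG.nonneg _))
              (mul_nonneg (by positivity) (hG.nonneg _))]
          exact ENNReal.ofReal_le_ofReal (hpt _ _)
      _ = ENNReal.ofReal (k / m) * (∫⁻ x in Ω, ENNReal.ofReal (G (u x / k))) +
            ENNReal.ofReal (((|c| + 1) * l) / m) * ∫⁻ x in Ω, ENNReal.ofReal (G (v x / l)) := by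
          rw [lintegral_add_left' ((hu.aemeasurable_div hG k).const_mul _),
            lintegral_const_mul'' _ (hu.aemeasurable_div hG k),
            lintegral_const_mul'' _ (hv.aemeasurable_div hG l)]
      _ ≤ ENNReal.ofReal (k / m) * 1 + ENNReal.ofReal (((|c| + 1) * l) / m) * 1 := by gcongr
      _ = 1 := by
          rw [mul_one, mul_one, ← ENNReal.ofReal_add (by positivity) (by positivity), ← add_div,
            ← hm, div_self hm0.ne', ENNReal.ofReal_one]
  refine le_of_forall_pos_le_add fun ε hε => ?_
  have h2c : 0 < |c| + 2 := by positivity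
  have := key (luxemburgNorm Ω G u + ε / (|c| + 2)) (luxemburgNorm Ω G v + ε / (|c| + 2))
    (by linarith [div_pos hε h2c]) (by linarith [div_pos hε h2c])
  refine this.trans_eq ?_
  field_simp
  ring

/-- The Luxemburg norm controls the `L¹` norm on bounded domains. -/
lemma exists_integral_abs_le (hG : IsNFunction G g) (hΩ : Bornology.IsBounded Ω) :
    ∃ C : ℝ, 0 ≤ C ∧ ∀ u, MemOrlicz Ω G u → ∫ x in Ω, |u x| ≤ C * luxemburgNorm Ω G u := by
  have _ : IsFiniteMeasure (volume.restrict Ω) := ⟨by simpa using hΩ.measure_lt_top⟩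
  have hg1 := hG.pos 1 one_pos
  -- Integrating |u| ≤ k (1 + G(u/k)/g(1)), where ∫ G(u/k) ≤ 1, gives k (|Ω| + 1/g(1)).
  set C := (volume.restrict Ω).real univ + (g 1)⁻¹ with hC
  have hC0 : 0 < C := by positivity
  refine ⟨C, hC0.le, fun u hu => ?_⟩
  have key : ∀ ε, luxemburgNorm Ω G u < ε → ∫ x in Ω, |u x| ≤ C * ε := by
    intro ε hε
    obtain ⟨k, hk0, hkε, hk⟩ := hu.exists_lt_of_luxemburgNorm_lt hG hε
    have hm : AEStronglyMeasurable (fun x => G (u x / k)) (volume.restrict Ω) :=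
      hG.continuous_G.comp_aestronglyMeasurable (hu.1.aemeasurable.div_const k).aestronglyMeasurable
    have hnn : 0 ≤ᵐ[volume.restrict Ω] fun x => G (u x / k) := ae_of_all _ fun x => hG.nonneg _
    have hint : IntegrableOn (fun x => G (u x / k)) Ω :=
      ⟨hm, (hasFiniteIntegral_iff_ofReal hnn).2 (hk.trans_lt ENNReal.one_lt_top)⟩
    have hle : ∫ x in Ω, G (u x / k) ≤ 1 := by
      rw [integral_eq_lintegral_of_nonneg_ae hnn hm]
      exact ENNReal.toReal_le_of_le_ofReal zero_le_one (by simpa using hk)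
    have hpt : ∀ x, |u x| ≤ k * (1 + (g 1)⁻¹ * G (u x / k)) := by
      intro x
      have := hG.abs_le (u x / k)
      rw [abs_div, abs_of_pos hk0, div_le_iff₀ hk0] at this
      linarith
    calc ∫ x in Ω, |u x| ≤ ∫ x in Ω, k * (1 + (g 1)⁻¹ * G (u x / k)) :=
          integral_mono (hu.integrable hG hΩ).abs
            (((integrable_const (1 : ℝ)).add (hint.const_mul _)).const_mul k) hpt
      _ = k * ((volume.restrict Ω).real univ + (g 1)⁻¹ * ∫ x in Ω, G (u x / k)) := by
          rw [integral_const_mul, integral_add (integrable_const _) (hint.const_mul _),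
            integral_const_mul, integral_const, smul_eq_mul, mul_one]
      _ ≤ k * C := by
          refine mul_le_mul_of_nonneg_left ?_ hk0.le
          have : (g 1)⁻¹ * ∫ x in Ω, G (u x / k) ≤ (g 1)⁻¹ * 1 :=
            mul_le_mul_of_nonneg_left hle (by positivity)
          linarith
      _ ≤ C * ε := by rw [mul_comm]; gcongr
  refine le_of_forall_pos_le_add fun ε hε => ?_
  refine (key (luxemburgNorm Ω G u + ε / C) (by linarith [div_pos hε hC0])).trans_eq ?_
  field_simp

end Orlicz

/-! ### Test functions and classical integration by parts -/

section TestFunctions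

variable {n : ℕ} {Ω : Set (EuclideanSpace ℝ (Fin n))} {φ ψ : EuclideanSpace ℝ (Fin n) → ℝ}

lemma contDiff_partialDeriv (hψ : ContDiff ℝ ∞ ψ) (i : Fin n) :
    ContDiff ℝ ∞ (partialDeriv i ψ) :=
  (hψ.fderiv_right (by simp)).clm_apply contDiff_const

lemma IsTestFunction.partialDeriv (hφ : IsTestFunction Ω φ) (i : Fin n) :
    IsTestFunction Ω (partialDeriv i φ) :=
  ⟨contDiff_partialDeriv hφ.1 i, hφ.2.1.fderiv_apply ℝ _,
    (tsupport_fderiv_apply_subset ℝ _).trans hφ.2.2⟩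

lemma IsTestFunction.partialDerivs (hφ : IsTestFunction Ω φ) (l : List (Fin n)) :
    IsTestFunction Ω (partialDerivs l φ) := by
  induction l with
  | nil => exact hφ
  | cons i l ih => exact ih.partialDeriv i

lemma IsTestFunction.eq_zero_of_notMem (hφ : IsTestFunction Ω φ)
    {x : EuclideanSpace ℝ (Fin n)} (hx : x ∉ Ω) : φ x = 0 :=
  image_eq_zero_of_notMem_tsupport fun h => hx (hφ.2.2 h)

lemma IsTestFunction.integrable_mul (hφ : IsTestFunction Ω φ) (hψ : Continuous ψ) :
    Integrable (fun x => φ x * ψ x) :=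
  (hφ.1.continuous.mul hψ).integrable_of_hasCompactSupport hφ.2.1.mul_right

lemma IsTestFunction.setIntegral_mul_partialDeriv (hφ : IsTestFunction Ω φ)
    (hψ : ContDiff ℝ ∞ ψ) (i : Fin n) :
    ∫ x in Ω, φ x * BiharmonicOrlicz.partialDeriv i ψ x =
      -∫ x in Ω, BiharmonicOrlicz.partialDeriv i φ x * ψ x := by
  rw [setIntegral_eq_integral_of_forall_compl_eq_zero fun x hx => by
      rw [hφ.eq_zero_of_notMem hx, zero_mul],
    setIntegral_eq_integral_of_forall_compl_eq_zero fun x hx => by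
      rw [(hφ.partialDeriv i).eq_zero_of_notMem hx, zero_mul]]
  exact integral_mul_fderiv_eq_neg_fderiv_mul_of_integrable
    ((hφ.partialDeriv i).integrable_mul hψ.continuous)
    (hφ.integrable_mul (contDiff_partialDeriv hψ i).continuous)
    (hφ.integrable_mul hψ.continuous)
    (fun x _ => hφ.1.differentiable (by simp) x) (fun x _ => hψ.differentiable (by simp) x)

lemma IsTestFunction.setIntegral_mul_partialDeriv₂ (hφ : IsTestFunction Ω φ)
    (hψ : ContDiff ℝ ∞ ψ) (i : Fin n) :
    ∫ x in Ω, φ x * BiharmonicOrlicz.partialDerivs [i, i] ψ x =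
      ∫ x in Ω, BiharmonicOrlicz.partialDerivs [i, i] φ x * ψ x := by
  simp only [BiharmonicOrlicz.partialDerivs, List.foldr_cons, List.foldr_nil]
  rw [hφ.setIntegral_mul_partialDeriv (contDiff_partialDeriv hψ i),
    (hφ.partialDeriv i).setIntegral_mul_partialDeriv hψ, neg_neg]

lemma IsTestFunction.locallyIntegrableOn (hφ : IsTestFunction Ω φ) : LocallyIntegrableOn φ Ω :=
  hφ.1.continuous.locallyIntegrable.locallyIntegrableOn Ω

/-- One derivative is moved across at a time, so `w` applies the partial derivatives in the order
opposite to `partialDerivs l`. Their symmetry is never needed. -/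
lemma IsTestFunction.exists_hasWeakDeriv (hφ : IsTestFunction Ω φ) (l : List (Fin n)) :
    ∃ w, HasWeakDeriv Ω l φ w ∧ IsTestFunction Ω w := by
  induction l generalizing φ with
  | nil => exact ⟨φ, ⟨hφ.locallyIntegrableOn, hφ.locallyIntegrableOn,
      fun ψ _ => by simp [BiharmonicOrlicz.partialDerivs]⟩, hφ⟩
  | cons i l ih =>
    obtain ⟨w, hw, hwt⟩ := ih (hφ.partialDeriv i)
    refine ⟨w, ⟨hφ.locallyIntegrableOn, hwt.locallyIntegrableOn, fun ψ hψ => ?_⟩, hwt⟩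
    have h1 := hφ.setIntegral_mul_partialDeriv (hψ.partialDerivs l).1 i
    rw [hw.2.2 ψ hψ] at h1
    change ∫ x in Ω, φ x * BiharmonicOrlicz.partialDeriv i (BiharmonicOrlicz.partialDerivs l ψ) x = _
    rw [h1, List.length_cons]
    ring

lemma IsTestFunction.hasWeakDeriv₂ (hφ : IsTestFunction Ω φ) (i : Fin n) :
    HasWeakDeriv Ω [i, i] φ (BiharmonicOrlicz.partialDerivs [i, i] φ) :=
  ⟨hφ.locallyIntegrableOn, (hφ.partialDerivs _).locallyIntegrableOn, fun ψ hψ => by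
    rw [hφ.setIntegral_mul_partialDeriv₂ hψ.1]; simp⟩

lemma IsTestFunction.add_mul (hφ : IsTestFunction Ω φ) (hψ : IsTestFunction Ω ψ) (c : ℝ) :
    IsTestFunction Ω (fun x => φ x + c * ψ x) := by
  have h : HasCompactSupport (fun x => c * ψ x) := hψ.2.1.mul_left
  refine ⟨hφ.1.add (contDiff_const.mul hψ.1), hφ.2.1.add h, ?_⟩
  refine (tsupport_add _ _).trans (union_subset hφ.2.2 ?_)
  exact (tsupport_mul_subset_right (f := fun _ => c)).trans hψ.2.2

end TestFunctions

/-! ### Linearity and uniqueness of weak derivatives -/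

section WeakDerivatives

variable {n : ℕ} {Ω : Set (EuclideanSpace ℝ (Fin n))} {l : List (Fin n)}
  {u v w w' : EuclideanSpace ℝ (Fin n) → ℝ}

lemma integrableOn_mul_testFunction (hu : LocallyIntegrableOn u Ω)
    {φ : EuclideanSpace ℝ (Fin n) → ℝ} (hφ : IsTestFunction Ω φ) :
    IntegrableOn (fun x => u x * φ x) Ω := by
  have h1 : IntegrableOn u (tsupport φ) := hu.integrableOn_compact_subset hφ.2.2 hφ.2.1
  have h2 : IntegrableOn (fun x => u x * φ x) (tsupport φ) :=
    h1.mul_continuousOn hφ.1.continuous.continuousOn hφ.2.1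
  rw [integrableOn_iff_integrable_of_support_subset] at h2
  · exact h2.integrableOn
  · exact (Function.support_mul_subset_right _ _).trans (subset_tsupport φ)

lemma HasWeakDeriv.add_mul (hu : HasWeakDeriv Ω l u w)
    (hv : HasWeakDeriv Ω l v w') (c : ℝ) :
    HasWeakDeriv Ω l (fun x => u x + c * v x) (fun x => w x + c * w' x) := by
  have hloc : ∀ {a b : EuclideanSpace ℝ (Fin n) → ℝ}, LocallyIntegrableOn a Ω →
      LocallyIntegrableOn b Ω → LocallyIntegrableOn (fun x => a x + c * b x) Ω :=
    fun ha hb => ha.add (hb.smul c)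
  refine ⟨hloc hu.1 hv.1, hloc hu.2.1 hv.2.1, fun φ hφ => ?_⟩
  have hsplit : ∀ {a b ψ : EuclideanSpace ℝ (Fin n) → ℝ}, LocallyIntegrableOn a Ω →
      LocallyIntegrableOn b Ω → IsTestFunction Ω ψ →
      ∫ x in Ω, (a x + c * b x) * ψ x = (∫ x in Ω, a x * ψ x) + c * ∫ x in Ω, b x * ψ x := by
    intro a b ψ ha hb hψ
    have h1 := integrableOn_mul_testFunction ha hψ
    have h2 := integrableOn_mul_testFunction hb hψ
    rw [← integral_const_mul, ← integral_add h1 (h2.const_mul c)]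
    exact integral_congr_ae (ae_of_all _ fun x => by ring)
  rw [hsplit hu.1 hv.1 (hφ.partialDerivs l), hsplit hu.2.1 hv.2.1 hφ, hu.2.2 φ hφ, hv.2.2 φ hφ]
  ring

/-- The fundamental lemma of the calculus of variations. It makes the representative chosen in
`weakDeriv` irrelevant up to a null set. -/
lemma HasWeakDeriv.ae_eq (hΩ : IsOpen Ω) (h : HasWeakDeriv Ω l u w)
    (h' : HasWeakDeriv Ω l u w') : w =ᵐ[volume.restrict Ω] w' := by
  have h0 : ∀ᵐ x, x ∈ Ω → (w - w') x = 0 := by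
    refine hΩ.ae_eq_zero_of_integral_contDiff_smul_eq_zero (h.2.1.sub h'.2.1) ?_
    intro φ h1 h2 h3
    have hφ : IsTestFunction Ω φ := ⟨h1, h2, h3⟩
    have he := (h.2.2 φ hφ).symm.trans (h'.2.2 φ hφ)
    have he' := mul_left_cancel₀ (pow_ne_zero _ (by norm_num : (-1 : ℝ) ≠ 0)) he
    rw [← setIntegral_eq_integral_of_forall_compl_eq_zero (s := Ω) fun x hx => by
      rw [hφ.eq_zero_of_notMem hx, zero_smul]]
    rw [← sub_eq_zero, ← integral_sub (integrableOn_mul_testFunction h.2.1 hφ)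
      (integrableOn_mul_testFunction h'.2.1 hφ)] at he'
    rw [← he']
    exact integral_congr_ae (ae_of_all _ fun x => by simp only [smul_eq_mul, Pi.sub_apply]; ring)
  filter_upwards [(ae_restrict_iff' hΩ.measurableSet).2 h0] with x hx
  exact sub_eq_zero.1 hx

lemma HasWeakDeriv.hasWeakDeriv_weakDeriv (h : HasWeakDeriv Ω l u w) :
    HasWeakDeriv Ω l u (weakDeriv Ω l u) := by
  have h' : ∃ w, HasWeakDeriv Ω l u w := ⟨w, h⟩
  rw [weakDeriv, dif_pos h']
  exact h'.choose_spec

lemma HasWeakDeriv.weakDeriv_ae_eq (hΩ : IsOpen Ω) (h : HasWeakDeriv Ω l u w) :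
    weakDeriv Ω l u =ᵐ[volume.restrict Ω] w :=
  h.hasWeakDeriv_weakDeriv.ae_eq hΩ h

end WeakDerivatives

/-! ### The spaces W^{2,G}(Ω) and W₀^{2,G}(Ω) -/

section Sobolev

variable {n : ℕ} {Ω : Set (EuclideanSpace ℝ (Fin n))} {G g : ℝ → ℝ} {pm pp : ℝ}
  {u v : EuclideanSpace ℝ (Fin n) → ℝ}

lemma MemW2.hasWeakDeriv (hu : MemW2 Ω G u) {l : List (Fin n)} (hl : l.length ≤ 2) :
    HasWeakDeriv Ω l u (weakDeriv Ω l u) := by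
  obtain ⟨w, hw, -⟩ := hu.2 l hl
  exact hw.hasWeakDeriv_weakDeriv

lemma MemW2.memOrlicz_weakDeriv (hΩ : IsOpen Ω) (hu : MemW2 Ω G u) {l : List (Fin n)}
    (hl : l.length ≤ 2) : MemOrlicz Ω G (weakDeriv Ω l u) := by
  obtain ⟨w, hw, hwm⟩ := hu.2 l hl
  exact hwm.congr (hw.weakDeriv_ae_eq hΩ).symm

lemma MemW2.weakDeriv_add_mul (hΩ : IsOpen Ω) (hu : MemW2 Ω G u) (hv : MemW2 Ω G v) (c : ℝ)
    {l : List (Fin n)} (hl : l.length ≤ 2) :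
    weakDeriv Ω l (fun x => u x + c * v x) =ᵐ[volume.restrict Ω]
      fun x => weakDeriv Ω l u x + c * weakDeriv Ω l v x :=
  ((hu.hasWeakDeriv hl).add_mul (hv.hasWeakDeriv hl) c).weakDeriv_ae_eq hΩ

lemma MemW2.add_mul (hΩ : IsOpen Ω) (hG : IsNFunction G g) (h : GrowthCondition G g pm pp)
    (hu : MemW2 Ω G u) (hv : MemW2 Ω G v) (c : ℝ) : MemW2 Ω G (fun x => u x + c * v x) :=
  ⟨hu.1.add hG h (hv.1.const_mul hG h c), fun _ hl =>
    ⟨_, (hu.hasWeakDeriv hl).add_mul (hv.hasWeakDeriv hl) c,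
      (hu.memOrlicz_weakDeriv hΩ hl).add hG h ((hv.memOrlicz_weakDeriv hΩ hl).const_mul hG h c)⟩⟩

lemma IsTestFunction.memW2 (hG : IsNFunction G g) {φ : EuclideanSpace ℝ (Fin n) → ℝ}
    (hφ : IsTestFunction Ω φ) : MemW2 Ω G φ := by
  refine ⟨memOrlicz_of_continuous hG hφ.1.continuous hφ.2.1, fun l _ => ?_⟩
  obtain ⟨w, hw, hwt⟩ := hφ.exists_hasWeakDeriv l
  exact ⟨w, hw, memOrlicz_of_continuous hG hwt.1.continuous hwt.2.1⟩

lemma MemW2.sub_testFunction (hΩ : IsOpen Ω) (hG : IsNFunction G g)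
    (h : GrowthCondition G g pm pp) (hu : MemW2 Ω G u) {φ : EuclideanSpace ℝ (Fin n) → ℝ}
    (hφ : IsTestFunction Ω φ) : MemW2 Ω G (u - φ) := by
  have := hu.add_mul hΩ hG h (hφ.memW2 hG) (-1)
  convert this using 2
  simp [sub_eq_add_neg]

lemma MemW2.normW2_add_mul_le (hΩ : IsOpen Ω) (hG : IsNFunction G g)
    (hu : MemW2 Ω G u) (hv : MemW2 Ω G v) (c : ℝ) :
    normW2 Ω G (fun x => u x + c * v x) ≤ normW2 Ω G u + (|c| + 1) * normW2 Ω G v := by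
  have key : ∀ l : List (Fin n), l.length ≤ 2 →
      luxemburgNorm Ω G (weakDeriv Ω l (fun x => u x + c * v x)) ≤
        luxemburgNorm Ω G (weakDeriv Ω l u) + (|c| + 1) * luxemburgNorm Ω G (weakDeriv Ω l v) := by
    intro l hl
    rw [luxemburgNorm_congr (hu.weakDeriv_add_mul hΩ hv c hl)]
    exact luxemburgNorm_add_mul_le hG (hu.memOrlicz_weakDeriv hΩ hl)
      (hv.memOrlicz_weakDeriv hΩ hl) c
  have h0 := luxemburgNorm_add_mul_le hG hu.1 hv.1 c
  have h1 := Finset.sum_le_sum fun (i : Fin n) (_ : i ∈ Finset.univ) => key [i] (by simp)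
  have h2 := Finset.sum_le_sum fun (i : Fin n) (_ : i ∈ Finset.univ) =>
    Finset.sum_le_sum fun (j : Fin n) (_ : j ∈ Finset.Ici i) => key [i, j] (by simp)
  simp only [Finset.sum_add_distrib, ← Finset.mul_sum] at h1 h2
  refine (add_le_add (add_le_add h0 h1) h2).trans_eq ?_
  rw [normW2, normW2]
  ring

lemma luxemburgNorm_le_normW2 : luxemburgNorm Ω G u ≤ normW2 Ω G u := by
  unfold normW2
  have h1 : 0 ≤ ∑ i, luxemburgNorm Ω G (weakDeriv Ω [i] u) :=
    Finset.sum_nonneg fun _ _ => luxemburgNorm_nonneg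
  have h2 : 0 ≤ ∑ i, ∑ j ∈ Finset.Ici i, luxemburgNorm Ω G (weakDeriv Ω [i, j] u) :=
    Finset.sum_nonneg fun _ _ => Finset.sum_nonneg fun _ _ => luxemburgNorm_nonneg
  linarith

lemma luxemburgNorm_weakDeriv₂_le_normW2 (i : Fin n) :
    luxemburgNorm Ω G (weakDeriv Ω [i, i] u) ≤ normW2 Ω G u := by
  unfold normW2
  have h0 : 0 ≤ luxemburgNorm Ω G u := luxemburgNorm_nonneg
  have h1 : 0 ≤ ∑ i, luxemburgNorm Ω G (weakDeriv Ω [i] u) :=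
    Finset.sum_nonneg fun _ _ => luxemburgNorm_nonneg
  have h2 : luxemburgNorm Ω G (weakDeriv Ω [i, i] u) ≤
      ∑ j ∈ Finset.Ici i, luxemburgNorm Ω G (weakDeriv Ω [i, j] u) :=
    Finset.single_le_sum (f := fun j => luxemburgNorm Ω G (weakDeriv Ω [i, j] u))
      (fun _ _ => luxemburgNorm_nonneg) (Finset.mem_Ici.2 le_rfl)
  have h3 : ∑ j ∈ Finset.Ici i, luxemburgNorm Ω G (weakDeriv Ω [i, j] u) ≤
      ∑ i, ∑ j ∈ Finset.Ici i, luxemburgNorm Ω G (weakDeriv Ω [i, j] u) :=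
    Finset.single_le_sum
      (f := fun i => ∑ j ∈ Finset.Ici i, luxemburgNorm Ω G (weakDeriv Ω [i, j] u))
      (fun _ _ => Finset.sum_nonneg fun _ _ => luxemburgNorm_nonneg) (Finset.mem_univ i)
  linarith

/-- `W₀^{2,G}(Ω)` is a linear space. -/
lemma MemW20.add_mul (hΩ : IsOpen Ω) (hG : IsNFunction G g) (h : GrowthCondition G g pm pp)
    (hu : MemW20 Ω G u) (hv : MemW20 Ω G v) (c : ℝ) : MemW20 Ω G (fun x => u x + c * v x) := by
  refine ⟨hu.1.add_mul hΩ hG h hv.1 c, fun ε hε => ?_⟩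
  have hc : 0 < |c| + 1 := by positivity
  obtain ⟨φ, hφ, hφε⟩ := hu.2 (ε / 2) (by positivity)
  obtain ⟨ψ, hψ, hψε⟩ := hv.2 (ε / 2 / (|c| + 1)) (by positivity)
  refine ⟨_, hφ.add_mul hψ c, ?_⟩
  have he : (fun x => u x + c * v x) - (fun x => φ x + c * ψ x) =
      fun x => (u - φ) x + c * (v - ψ) x := by
    ext x; simp only [Pi.sub_apply]; ring
  rw [he]
  refine ((hu.1.sub_testFunction hΩ hG h hφ).normW2_add_mul_le hΩ hG
    (hv.1.sub_testFunction hΩ hG h hψ) c).trans_lt ?_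
  rw [lt_div_iff₀ hc] at hψε
  linarith

lemma MemW20.const_mul (hΩ : IsOpen Ω) (hG : IsNFunction G g) (h : GrowthCondition G g pm pp)
    (hu : MemW20 Ω G u) (c : ℝ) : MemW20 Ω G (fun x => c * u x) := by
  -- cu is written as u + (c - 1)u.
  have := hu.add_mul hΩ hG h hu (c - 1)
  convert this using 2
  ring

lemma MemW2.weakLaplacian_add_mul (hΩ : IsOpen Ω) (hu : MemW2 Ω G u) (hv : MemW2 Ω G v) (c : ℝ) :
    weakLaplacian Ω (fun x => u x + c * v x) =ᵐ[volume.restrict Ω]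
      fun x => weakLaplacian Ω u x + c * weakLaplacian Ω v x := by
  have : ∀ i : Fin n, _ := fun i => hu.weakDeriv_add_mul hΩ hv c (l := [i, i]) (by simp)
  filter_upwards [ae_all_iff.2 this] with x hx
  simp only [weakLaplacian, hx, Finset.sum_add_distrib, Finset.mul_sum]

lemma MemW2.weakLaplacian_const_mul (hΩ : IsOpen Ω) (hu : MemW2 Ω G u) (c : ℝ) :
    weakLaplacian Ω (fun x => c * u x) =ᵐ[volume.restrict Ω]
      fun x => c * weakLaplacian Ω u x := by
  have := hu.weakLaplacian_add_mul hΩ hu (c - 1)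
  have he : (fun x => u x + (c - 1) * u x) = fun x => c * u x := by ext; ring
  rw [he] at this
  filter_upwards [this] with x hx
  rw [hx]; ring

lemma MemW2.memOrlicz_weakLaplacian (hΩ : IsOpen Ω) (hG : IsNFunction G g)
    (h : GrowthCondition G g pm pp) (hu : MemW2 Ω G u) : MemOrlicz Ω G (weakLaplacian Ω u) :=
  MemOrlicz.sum hG h Finset.univ fun _ _ => hu.memOrlicz_weakDeriv hΩ (by simp)

/-- Functions in `W₀^{2,G}(Ω)` can be integrated by parts against any smooth function. -/
lemma MemW20.setIntegral_mul_partialDeriv₂ (hΩ : IsOpen Ω) (hΩb : Bornology.IsBounded Ω)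
    (hG : IsNFunction G g) (h : GrowthCondition G g pm pp) (hu : MemW20 Ω G u)
    {ψ : EuclideanSpace ℝ (Fin n) → ℝ} (hψ : ContDiff ℝ ∞ ψ) (i : Fin n) :
    ∫ x in Ω, u x * partialDerivs [i, i] ψ x = ∫ x in Ω, weakDeriv Ω [i, i] u x * ψ x := by
  have hψ2 : Continuous (partialDerivs [i, i] ψ) :=
    (contDiff_partialDeriv (contDiff_partialDeriv hψ i) i).continuous
  have hbd : ∀ f : EuclideanSpace ℝ (Fin n) → ℝ, Continuous f →
      ∃ M : ℝ, 0 ≤ M ∧ ∀ x ∈ Ω, ‖f x‖ ≤ M := by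
    intro f hf
    obtain ⟨M, hM⟩ := hΩb.isCompact_closure.exists_bound_of_continuousOn hf.continuousOn
    exact ⟨max M 0, le_max_right _ _, fun x hx =>
      (hM x (subset_closure hx)).trans (le_max_left _ _)⟩
  have hint : ∀ a f : EuclideanSpace ℝ (Fin n) → ℝ, IntegrableOn a Ω → Continuous f →
      IntegrableOn (fun x => a x * f x) Ω := by
    intro a f ha hf
    obtain ⟨M, -, hM⟩ := hbd f hf
    exact ha.mul_bdd (c := M) hf.aestronglyMeasurable (ae_restrict_of_forall_mem hΩ.measurableSet hM)
  have hest : ∀ (a f : EuclideanSpace ℝ (Fin n) → ℝ) (M : ℝ), IntegrableOn a Ω → Continuous f →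
      (∀ x ∈ Ω, ‖f x‖ ≤ M) → |∫ x in Ω, a x * f x| ≤ (∫ x in Ω, |a x|) * M := by
    intro a f M ha hf hM
    rw [← integral_mul_const]
    refine (abs_integral_le_integral_abs).trans ?_
    refine setIntegral_mono_on (hint a f ha hf).abs (ha.abs.mul_const M) hΩ.measurableSet ?_
    intro x hx
    rw [abs_mul]
    exact mul_le_mul_of_nonneg_left (hM x hx) (abs_nonneg _)
  obtain ⟨M, hM0, hM⟩ := hbd ψ hψ.continuous
  obtain ⟨M', hM0', hM'⟩ := hbd _ hψ2
  obtain ⟨C, hC0, hC⟩ := exists_integral_abs_le hG hΩb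
  have hl : [i, i].length ≤ 2 := by simp
  -- The identity holds exactly for a test function φ, so its defect for u equals its defect for u -
  -- φ. With φ close to u in norm, this is small because ψ and its second derivative are bounded on
  -- Ω and the norm controls L¹. The zero boundary values enter here: ψ need not vanish near ∂Ω.
  have key : ∀ ε : ℝ, 0 < ε → |(∫ x in Ω, u x * partialDerivs [i, i] ψ x) -
      ∫ x in Ω, weakDeriv Ω [i, i] u x * ψ x| ≤ (C * (M + M')) * ε := by
    intro ε hε
    obtain ⟨φ, hφ, hφε⟩ := hu.2 ε hε
    have hmem := hu.1.sub_testFunction hΩ hG h hφ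
    have hw := hmem.memOrlicz_weakDeriv hΩ hl
    have ha : weakDeriv Ω [i, i] (u - φ) =ᵐ[volume.restrict Ω]
        fun x => weakDeriv Ω [i, i] u x - partialDerivs [i, i] φ x := by
      have := ((hu.1.hasWeakDeriv hl).add_mul (hφ.hasWeakDeriv₂ i) (-1)).weakDeriv_ae_eq hΩ
      simpa only [neg_one_mul, ← sub_eq_add_neg, ← Pi.sub_def] using this
    have iu := hu.1.1.integrable hG hΩb
    have iw := (hu.1.memOrlicz_weakDeriv hΩ hl).integrable hG hΩb
    have iφ := (hφ.memW2 hG).1.integrable hG hΩb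
    have iφ2 := ((hφ.partialDerivs [i, i]).memW2 hG).1.integrable hG hΩb
    have e1 : ∫ x in Ω, (u - φ) x * partialDerivs [i, i] ψ x =
        (∫ x in Ω, u x * partialDerivs [i, i] ψ x) - ∫ x in Ω, φ x * partialDerivs [i, i] ψ x := by
      rw [← integral_sub (hint _ _ iu hψ2) (hint _ _ iφ hψ2)]
      simp only [Pi.sub_apply, sub_mul]
    have e2 : ∫ x in Ω, weakDeriv Ω [i, i] (u - φ) x * ψ x =
        (∫ x in Ω, weakDeriv Ω [i, i] u x * ψ x) - ∫ x in Ω, partialDerivs [i, i] φ x * ψ x := by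
      rw [← integral_sub (hint _ _ iw hψ.continuous) (hint _ _ iφ2 hψ.continuous)]
      refine integral_congr_ae ?_
      filter_upwards [ha] with x hx
      rw [hx, sub_mul]
    have e3 := hφ.setIntegral_mul_partialDeriv₂ hψ i
    have b1 := hest _ _ M' (hmem.1.integrable hG hΩb) hψ2 hM'
    have b2 := hest _ _ M (hw.integrable hG hΩb) hψ.continuous hM
    have c1 : ∫ x in Ω, |(u - φ) x| ≤ C * ε := (hC _ hmem.1).trans
      (mul_le_mul_of_nonneg_left (luxemburgNorm_le_normW2.trans hφε.le) hC0)
    have c2 : ∫ x in Ω, |weakDeriv Ω [i, i] (u - φ) x| ≤ C * ε := (hC _ hw).trans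
      (mul_le_mul_of_nonneg_left ((luxemburgNorm_weakDeriv₂_le_normW2 i).trans hφε.le) hC0)
    have d1 := b1.trans (mul_le_mul_of_nonneg_right c1 hM0')
    have d2 := b2.trans (mul_le_mul_of_nonneg_right c2 hM0)
    have e4 : (∫ x in Ω, u x * partialDerivs [i, i] ψ x) -
        ∫ x in Ω, weakDeriv Ω [i, i] u x * ψ x =
        (∫ x in Ω, (u - φ) x * partialDerivs [i, i] ψ x) -
          ∫ x in Ω, weakDeriv Ω [i, i] (u - φ) x * ψ x := by
      rw [e1, e2, e3]; ring
    rw [e4]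
    refine (abs_sub _ _).trans ?_
    linarith
  rw [← sub_eq_zero, ← abs_nonpos_iff]
  refine le_of_forall_pos_le_add fun ε hε => ?_
  -- The added 1 covers the case C (M + M') = 0.
  have hK : 0 < C * (M + M') + 1 := by positivity
  refine (key (ε / (C * (M + M') + 1)) (by positivity)).trans ?_
  rw [zero_add, mul_div_assoc', div_le_iff₀ hK]
  nlinarith

end Sobolev

/-! ### Uniqueness for the Dirichlet problem via the Fourier transform -/

section Uniqueness

variable {n : ℕ} {Ω : Set (EuclideanSpace ℝ (Fin n))} {G g : ℝ → ℝ} {pm pp : ℝ}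
  {u : EuclideanSpace ℝ (Fin n) → ℝ}

lemma integrable_exp_mul_charFun {μ : Measure (EuclideanSpace ℝ (Fin n))}
    {f : EuclideanSpace ℝ (Fin n) → ℝ} (hf : Integrable f μ) (ξ : EuclideanSpace ℝ (Fin n)) :
    Integrable (fun x => (f x : ℂ) * Complex.exp (inner ℝ x ξ * Complex.I)) μ :=
  hf.ofReal.mul_bdd (c := 1) (by fun_prop)
    (ae_of_all _ fun x => by rw [Complex.norm_exp_ofReal_mul_I])

/-- Characteristic functions are taken of positive measures, so a signed f is split into the
measures with densities f⁺ and f⁻; `ENNReal.ofReal` performs the truncation. -/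
lemma charFun_withDensity_ofReal {μ : Measure (EuclideanSpace ℝ (Fin n))}
    {f : EuclideanSpace ℝ (Fin n) → ℝ} (hf : AEMeasurable f μ) (ξ : EuclideanSpace ℝ (Fin n)) :
    charFun (μ.withDensity fun x => ENNReal.ofReal (f x)) ξ =
      ∫ x, ((max (f x) 0 : ℝ) : ℂ) * Complex.exp (inner ℝ x ξ * Complex.I) ∂μ := by
  rw [charFun_apply, integral_withDensity_eq_integral_toReal_smul₀ hf.ennreal_ofReal
    (ae_of_all _ fun _ => ENNReal.ofReal_lt_top)]
  simp only [ENNReal.toReal_ofReal', Complex.real_smul]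

/-- An integrable function is determined by its Fourier transform away from the origin. -/
lemma ae_eq_zero_of_integral_cos_sin [NeZero n] {μ : Measure (EuclideanSpace ℝ (Fin n))}
    [SFinite μ] {f : EuclideanSpace ℝ (Fin n) → ℝ} (hf : Integrable f μ)
    (hcos : ∀ ξ : EuclideanSpace ℝ (Fin n), ξ ≠ 0 → ∫ x, f x * Real.cos (inner ℝ x ξ) ∂μ = 0)
    (hsin : ∀ ξ : EuclideanSpace ℝ (Fin n), ξ ≠ 0 → ∫ x, f x * Real.sin (inner ℝ x ξ) ∂μ = 0) :
    f =ᵐ[μ] 0 := by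
  have hfm := hf.1.aemeasurable
  have hfm' : AEMeasurable (fun x => -f x) μ := hfm.neg
  have : IsFiniteMeasure (μ.withDensity fun x => ENNReal.ofReal (f x)) :=
    isFiniteMeasure_withDensity_ofReal hf.2
  have : IsFiniteMeasure (μ.withDensity fun x => ENNReal.ofReal (-f x)) :=
    isFiniteMeasure_withDensity_ofReal hf.neg.2
  have hne : ∀ ξ : EuclideanSpace ℝ (Fin n), ξ ≠ 0 →
      charFun (μ.withDensity fun x => ENNReal.ofReal (f x)) ξ =
        charFun (μ.withDensity fun x => ENNReal.ofReal (-f x)) ξ := by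
    intro ξ hξ
    rw [charFun_withDensity_ofReal hfm, charFun_withDensity_ofReal hfm', ← sub_eq_zero,
      ← integral_sub (integrable_exp_mul_charFun hf.pos_part ξ)
        (integrable_exp_mul_charFun hf.neg_part ξ)]
    have hpt : ∀ x, ((max (f x) 0 : ℝ) : ℂ) * Complex.exp (inner ℝ x ξ * Complex.I) -
        ((max (-f x) 0 : ℝ) : ℂ) * Complex.exp (inner ℝ x ξ * Complex.I) =
        ((f x * Real.cos (inner ℝ x ξ) : ℝ) : ℂ) +
          ((f x * Real.sin (inner ℝ x ξ) : ℝ) : ℂ) * Complex.I := by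
      intro x
      have hm : max (f x) 0 - max (-f x) 0 = f x := by
        rcases le_total 0 (f x) with h | h
        · rw [max_eq_left h, max_eq_right (by linarith)]; ring
        · rw [max_eq_right h, max_eq_left (by linarith)]; ring
      rw [← sub_mul, ← Complex.ofReal_sub, hm, Complex.exp_mul_I]
      push_cast
      ring
    simp_rw [hpt]
    have i1 : Integrable (fun x => f x * Real.cos (inner ℝ x ξ)) μ :=
      hf.mul_bdd (c := 1) (by fun_prop) (ae_of_all _ fun x => Real.abs_cos_le_one _)
    have i2 : Integrable (fun x => f x * Real.sin (inner ℝ x ξ)) μ :=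
      hf.mul_bdd (c := 1) (by fun_prop) (ae_of_all _ fun x => Real.abs_sin_le_one _)
    rw [integral_add i1.ofReal (i2.ofReal.mul_const _), integral_mul_const,
      integral_complex_ofReal, integral_complex_ofReal, hcos ξ hξ, hsin ξ hξ]
    simp
  have heq : charFun (μ.withDensity fun x => ENNReal.ofReal (f x)) =
      charFun (μ.withDensity fun x => ENNReal.ofReal (-f x)) :=
    -- The complement of the origin is dense because n ≥ 1, so continuity supplies the missing
    -- frequency ξ = 0.
    Continuous.ext_on (dense_compl_singleton (0 : EuclideanSpace ℝ (Fin n)))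
      continuous_charFun continuous_charFun fun ξ hξ => hne ξ hξ
  have hd := Measure.ext_of_charFun heq
  rw [withDensity_eq_iff hfm.ennreal_ofReal hfm'.ennreal_ofReal
    (by rw [← lt_top_iff_ne_top]; exact hf.lintegral_lt_top)] at hd
  filter_upwards [hd] with x hx
  rcases le_total 0 (f x) with h | h
  · rw [ENNReal.ofReal_of_nonpos (by linarith : -f x ≤ 0), ENNReal.ofReal_eq_zero] at hx
    exact le_antisymm hx h
  · rw [ENNReal.ofReal_of_nonpos h, eq_comm, ENNReal.ofReal_eq_zero] at hx
    exact le_antisymm h (neg_nonpos.1 hx)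

lemma partialDeriv_comp_inner {F F' : ℝ → ℝ} (hF : ∀ t, HasDerivAt F (F' t) t) (i : Fin n)
    (ξ : EuclideanSpace ℝ (Fin n)) :
    partialDeriv i (fun x => F (inner ℝ x ξ)) = fun x => F' (inner ℝ x ξ) * ξ i := by
  ext x
  have h1 : HasFDerivAt (fun x : EuclideanSpace ℝ (Fin n) => inner ℝ x ξ) (innerSL ℝ ξ) x := by
    have he : (fun x : EuclideanSpace ℝ (Fin n) => inner ℝ x ξ) = innerSL ℝ ξ :=
      funext fun x => real_inner_comm ξ x
    rw [he]
    exact (innerSL ℝ ξ).hasFDerivAt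
  have h2 := (hF (inner ℝ x ξ)).comp_hasFDerivAt x h1
  simp only [Function.comp_def] at h2
  rw [partialDeriv, h2.fderiv]
  simp [EuclideanSpace.inner_single_right]

lemma partialDeriv_mul_const {f : EuclideanSpace ℝ (Fin n) → ℝ} (hf : Differentiable ℝ f)
    (i : Fin n) (c : ℝ) :
    partialDeriv i (fun x => f x * c) = fun x => partialDeriv i f x * c := by
  ext x
  rw [partialDeriv, fderiv_mul_const (hf x)]
  simp [partialDeriv, mul_comm]

/-- The Dirichlet problem for the Laplacian has only the trivial solution in `W₀^{2,G}(Ω)`. -/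
lemma MemW20.ae_eq_zero_of_weakLaplacian [NeZero n] (hΩ : IsOpen Ω)
    (hΩb : Bornology.IsBounded Ω) (hG : IsNFunction G g) (h : GrowthCondition G g pm pp)
    (hu : MemW20 Ω G u) (h0 : weakLaplacian Ω u =ᵐ[volume.restrict Ω] 0) :
    u =ᵐ[volume.restrict Ω] 0 := by
  -- For F'' = -F the plane wave ψ(x) = F(x·ξ) satisfies Δψ = -|ξ|²ψ, so 0 = ∫ Δu ψ = -|ξ|² ∫ u ψ.
  have key : ∀ (F F' : ℝ → ℝ), (∀ t, HasDerivAt F (F' t) t) → (∀ t, HasDerivAt F' (-F t) t) →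
      ContDiff ℝ ∞ F → (∀ t, |F t| ≤ 1) → ∀ ξ : EuclideanSpace ℝ (Fin n), ξ ≠ 0 →
      ∫ x in Ω, u x * F (inner ℝ x ξ) = 0 := by
    intro F F' hF hF' hFc hFb ξ hξ
    set ψ : EuclideanSpace ℝ (Fin n) → ℝ := fun x => F (inner ℝ x ξ) with hψdef
    have hψ : ContDiff ℝ ∞ ψ := hFc.comp (contDiff_id.inner ℝ contDiff_const)
    have hpd : ∀ i : Fin n, partialDerivs [i, i] ψ = fun x => -(ψ x * (ξ i) ^ 2) := by
      intro i
      simp only [partialDerivs, List.foldr_cons, List.foldr_nil]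
      have hd : Differentiable ℝ fun x : EuclideanSpace ℝ (Fin n) => F' (inner ℝ x ξ) :=
        Differentiable.comp (g := F') (fun t => (hF' t).differentiableAt)
          (differentiable_id.inner ℝ (differentiable_const ξ))
      rw [hψdef, partialDeriv_comp_inner hF, partialDeriv_mul_const hd,
        partialDeriv_comp_inner hF']
      ext x
      ring
    have hi : ∀ i : Fin n, IntegrableOn (fun x => weakDeriv Ω [i, i] u x * ψ x) Ω := fun i =>
      ((hu.1.memOrlicz_weakDeriv hΩ (by simp)).integrable hG hΩb).mul_bdd (c := 1)
        hψ.continuous.aestronglyMeasurable (ae_of_all _ fun x => hFb _)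
    have h1 : ∑ i : Fin n, ∫ x in Ω, weakDeriv Ω [i, i] u x * ψ x = 0 := by
      rw [← integral_finsetSum _ fun i _ => hi i]
      rw [← integral_zero (EuclideanSpace ℝ (Fin n)) ℝ (μ := volume.restrict Ω)]
      refine integral_congr_ae ?_
      filter_upwards [h0] with x hx
      rw [← Finset.sum_mul]
      change weakLaplacian Ω u x * ψ x = 0
      rw [hx, Pi.zero_apply, zero_mul]
    have h2 : ∀ i : Fin n, ∫ x in Ω, weakDeriv Ω [i, i] u x * ψ x =
        -((∫ x in Ω, u x * ψ x) * (ξ i) ^ 2) := by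
      intro i
      rw [← hu.setIntegral_mul_partialDeriv₂ hΩ hΩb hG h hψ i, hpd i, ← integral_mul_const,
        ← integral_neg]
      exact integral_congr_ae (ae_of_all _ fun x => by ring)
    simp only [h2, Finset.sum_neg_distrib, ← Finset.mul_sum, neg_eq_zero, mul_eq_zero] at h1
    refine h1.resolve_right fun hs => hξ ?_
    rw [← norm_eq_zero, EuclideanSpace.norm_eq]
    simp [hs]
  refine ae_eq_zero_of_integral_cos_sin (hu.1.1.integrable hG hΩb) ?_ ?_
  · refine key Real.cos (fun t => -Real.sin t) Real.hasDerivAt_cos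
      (fun t => (Real.hasDerivAt_sin t).neg) Real.contDiff_cos Real.abs_cos_le_one
  · refine key Real.sin Real.cos Real.hasDerivAt_sin Real.hasDerivAt_cos Real.contDiff_sin
      Real.abs_sin_le_one

end Uniqueness

/-! ### Variational inequalities for the minimizer -/

section Minimizers

variable {n : ℕ} {Ω : Set (EuclideanSpace ℝ (Fin n))} {G g : ℝ → ℝ} {pm pp r : ℝ}
  {u v w : EuclideanSpace ℝ (Fin n) → ℝ}

/-- The tangent inequality for G, integrated; it holds for ε of either sign, with no limit taken. -/
lemma modular_add_mul_ge (hG : IsNFunction G g) (h : GrowthCondition G g pm pp)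
    (hu : MemOrlicz Ω G u) (hv : MemOrlicz Ω G v) (ε : ℝ) :
    modular Ω G u + ε * ∫ x in Ω, g (u x) * v x ≤ modular Ω G (fun x => u x + ε * v x) := by
  unfold modular
  rw [← integral_const_mul, ← integral_add hu.2 ((hu.integrable_g_mul hG h hv).const_mul ε)]
  refine integral_mono (hu.2.add ((hu.integrable_g_mul hG h hv).const_mul ε))
    (hu.add hG h (hv.const_mul hG h ε)).2 fun x => ?_
  refine le_trans (le_of_eq ?_) (hG.tangent_le (u x) (ε * v x))
  ring

lemma modular_add_mul_le (hG : IsNFunction G g) (h : GrowthCondition G g pm pp)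
    (hu : MemOrlicz Ω G u) (hv : MemOrlicz Ω G v) (ε : ℝ) :
    modular Ω G (fun x => u x + ε * v x) ≤
      modular Ω G u + ε * ∫ x in Ω, g (u x + ε * v x) * v x := by
  -- The lower bound again, now based at u + εv with step -ε back to u.
  have := modular_add_mul_ge hG h (hu.add hG h (hv.const_mul hG h ε)) hv (-ε)
  simp only [neg_mul, add_neg_cancel_right] at this
  linarith

lemma tendsto_integral_g_add_mul (hG : IsNFunction G g) (h : GrowthCondition G g pm pp)
    (hu : MemOrlicz Ω G u) (hv : MemOrlicz Ω G v) :
    Tendsto (fun ε : ℝ => ∫ x in Ω, g (u x + ε * v x) * v x) (nhds 0)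
      (nhds (∫ x in Ω, g (u x) * v x)) := by
  refine tendsto_integral_filter_of_dominated_convergence
    -- A majorant uniform in |ε| < 1: the Young-type inequality, then G(u + εv) ≤ G(2u) + G(2v).
    (fun x => pp * (G (2 * u x) + G (2 * v x) + G (v x))) ?_ ?_ ?_ ?_
  · exact Eventually.of_forall fun ε =>
      ((hu.add hG h (hv.const_mul hG h ε)).integrable_g_mul hG h hv).1
  · filter_upwards [Metric.ball_mem_nhds (0 : ℝ) one_pos] with ε hε
    rw [mem_ball_zero_iff, Real.norm_eq_abs] at hε
    refine ae_of_all _ fun x => (hG.abs_g_mul_le h _ _).trans ?_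
    refine mul_le_mul_of_nonneg_left (add_le_add ((hG.G_add_le _ _).trans ?_) le_rfl) h.pp_pos.le
    refine add_le_add le_rfl (hG.G_le_of_abs_le ?_)
    rw [abs_mul, abs_mul, abs_mul]
    exact mul_le_mul_of_nonneg_left (mul_le_of_le_one_left (abs_nonneg _) hε.le) (abs_nonneg _)
  · exact (((hu.const_mul hG h 2).2.add (hv.const_mul hG h 2).2).add hv.2).const_mul pp
  · refine ae_of_all _ fun x => ?_
    have hc : Continuous fun ε : ℝ => g (u x + ε * v x) * v x :=
      (hG.continuous.comp (by fun_prop)).mul continuous_const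
    simpa using hc.tendsto 0

lemma continuousOn_modular_const_mul (hG : IsNFunction G g) (hu : MemOrlicz Ω G u) :
    ContinuousOn (fun t : ℝ => modular Ω G fun x => t * u x) (Icc 0 1) := by
  refine continuousOn_of_dominated (bound := fun x => G (u x)) ?_ ?_ hu.2 ?_
  · exact fun t _ => hG.continuous_G.comp_aestronglyMeasurable (hu.1.const_mul t)
  · refine fun t ht => ae_of_all _ fun x => ?_
    rw [Real.norm_of_nonneg (hG.nonneg _)]
    apply hG.G_le_of_abs_le
    rw [abs_mul, abs_of_nonneg ht.1]
    exact mul_le_of_le_one_left (abs_nonneg _) ht.2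
  · exact ae_of_all _ fun x =>
      (hG.continuous_G.comp (continuous_id.mul continuous_const)).continuousOn

lemma modular_nonneg (hG : IsNFunction G g) : 0 ≤ modular Ω G u :=
  integral_nonneg fun _ => hG.nonneg _

lemma modular_const_mul_le (hG : IsNFunction G g) (h : GrowthCondition G g pm pp)
    (hu : MemOrlicz Ω G u) {t : ℝ} (ht : t ∈ Icc (0 : ℝ) 1) :
    modular Ω G (fun x => t * u x) ≤ modular Ω G u := by
  refine integral_mono (hu.const_mul hG h t).2 hu.2 fun x => hG.G_le_of_abs_le ?_
  rw [abs_mul, abs_of_nonneg ht.1]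
  exact mul_le_of_le_one_left (abs_nonneg _) ht.2

/-- A minimizer also minimizes under the relaxed constraint `∫_Ω G(v) dx ≥ r`. -/
lemma IsConstrainedMinimizer.modular_le (hΩ : IsOpen Ω) (hG : IsNFunction G g)
    (h : GrowthCondition G g pm pp) (hr : 0 ≤ r) (hu : IsConstrainedMinimizer Ω G r u)
    (hv : MemW20 Ω G v) (hrv : r ≤ modular Ω G v) :
    modular Ω G (weakLaplacian Ω u) ≤ modular Ω G (weakLaplacian Ω v) := by
  -- The modular of tv runs continuously from 0 to at least r, so some t in [0, 1] meets the
  -- constraint exactly. Multiplying by such a t does not increase the energy.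
  obtain ⟨t, ht, htr⟩ : r ∈ (fun t : ℝ => modular Ω G fun x => t * v x) '' Icc 0 1 := by
    refine intermediate_value_Icc zero_le_one (continuousOn_modular_const_mul hG hv.1.1) ⟨?_, ?_⟩
    · simpa [modular, hG.G_zero] using hr
    · simpa using hrv
  rw [hu.2.2]
  calc constrainedInf Ω G r ≤ modular Ω G (weakLaplacian Ω fun x => t * v x) := by
        refine csInf_le ⟨0, ?_⟩ ⟨_, hv.const_mul hΩ hG h t, htr, rfl⟩
        rintro _ ⟨v, -, -, rfl⟩
        exact modular_nonneg hG
    _ = modular Ω G (fun x => t * weakLaplacian Ω v x) :=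
        modular_congr (hv.1.weakLaplacian_const_mul hΩ t)
    _ ≤ modular Ω G (weakLaplacian Ω v) :=
        modular_const_mul_le hG h (hv.1.memOrlicz_weakLaplacian hΩ hG h) ht

/-- The energy does not decrease in directions in which the constraint increases. -/
lemma IsConstrainedMinimizer.integral_nonneg (hΩ : IsOpen Ω) (hG : IsNFunction G g)
    (h : GrowthCondition G g pm pp) (hr : 0 ≤ r) (hu : IsConstrainedMinimizer Ω G r u)
    (hv : MemW20 Ω G v) (hpos : 0 < ∫ x in Ω, g (u x) * v x) :
    0 ≤ ∫ x in Ω, g (weakLaplacian Ω u x) * weakLaplacian Ω v x := by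
  by_contra! hneg
  have hLu := hu.1.1.memOrlicz_weakLaplacian hΩ hG h
  have hLv := hv.1.memOrlicz_weakLaplacian hΩ hG h
  have hev := ((tendsto_integral_g_add_mul hG h hLu hLv).eventually_lt_const hneg).filter_mono
    (nhdsWithin_le_nhds (s := Ioi 0))
  -- For this ε the competitor u + εv has modular above r but energy strictly below that of u.
  obtain ⟨ε, hε, hε0⟩ := (hev.and self_mem_nhdsWithin).exists
  have hε0 : 0 < ε := hε0
  have h1 := modular_add_mul_ge hG h hu.1.1.1 hv.1.1 ε
  have h2 := modular_add_mul_le hG h hLu hLv ε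
  rw [hu.2.1] at h1
  have h3 := hu.modular_le hΩ hG h hr (hu.1.add_mul hΩ hG h hv ε)
    (by linarith [mul_pos hε0 hpos])
  rw [modular_congr (hu.1.1.weakLaplacian_add_mul hΩ hv.1 ε)] at h3
  linarith [mul_neg_of_pos_of_neg hε0 hε]

/-- The bilinear pairing `∫_Ω g(u) v dx` is linear in `v`. -/
lemma MemOrlicz.integral_g_mul_add_mul (hG : IsNFunction G g) (h : GrowthCondition G g pm pp)
    (hu : MemOrlicz Ω G u) (hv : MemOrlicz Ω G v) (hw : MemOrlicz Ω G w) (c : ℝ) :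
    ∫ x in Ω, g (u x) * (v x + c * w x) =
      (∫ x in Ω, g (u x) * v x) + c * ∫ x in Ω, g (u x) * w x := by
  rw [← integral_const_mul, ← integral_add (hu.integrable_g_mul hG h hv)
    ((hu.integrable_g_mul hG h hw).const_mul c)]
  exact integral_congr_ae (ae_of_all _ fun x => by ring)

lemma MemW2.integral_g_mul_weakLaplacian_add_mul (hΩ : IsOpen Ω) (hG : IsNFunction G g)
    (h : GrowthCondition G g pm pp) (hu : MemOrlicz Ω G u) (hv : MemW2 Ω G v) (hw : MemW2 Ω G w)
    (c : ℝ) :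
    ∫ x in Ω, g (u x) * weakLaplacian Ω (fun x => v x + c * w x) x =
      (∫ x in Ω, g (u x) * weakLaplacian Ω v x) + c * ∫ x in Ω, g (u x) * weakLaplacian Ω w x := by
  rw [← hu.integral_g_mul_add_mul hG h (hv.memOrlicz_weakLaplacian hΩ hG h)
    (hw.memOrlicz_weakLaplacian hΩ hG h)]
  refine integral_congr_ae ?_
  filter_upwards [hv.weakLaplacian_add_mul hΩ hw c] with x hx
  rw [hx]

lemma modular_le_integral_g_mul_self (hG : IsNFunction G g) (h : GrowthCondition G g pm pp)
    (hu : MemOrlicz Ω G u) : modular Ω G u ≤ ∫ x in Ω, g (u x) * u x :=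
  integral_mono hu.2 (hu.integrable_g_mul hG h hu) fun _ => hG.G_le_mul_self _

/-- The integrand g(s)s is nonnegative and vanishes only at s = 0, so a zero integral would force Δu
= 0, hence u = 0 and r = 0. -/
lemma IsConstrainedMinimizer.integral_self_pos [NeZero n] (hΩ : IsOpen Ω)
    (hΩb : Bornology.IsBounded Ω) (hG : IsNFunction G g) (h : GrowthCondition G g pm pp)
    (hr : 0 < r) (hu : IsConstrainedMinimizer Ω G r u) :
    0 < ∫ x in Ω, g (weakLaplacian Ω u x) * weakLaplacian Ω u x := by
  have hLu := hu.1.1.memOrlicz_weakLaplacian hΩ hG h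
  have hnn : 0 ≤ fun x => g (weakLaplacian Ω u x) * weakLaplacian Ω u x :=
    fun x => hG.g_mul_self_nonneg _
  refine (MeasureTheory.integral_nonneg hnn).lt_of_ne fun h0 => ?_
  rw [eq_comm, integral_eq_zero_iff_of_nonneg hnn (hLu.integrable_g_mul hG h hLu)] at h0
  have hL0 : weakLaplacian Ω u =ᵐ[volume.restrict Ω] 0 := by
    filter_upwards [h0] with x hx
    exact hG.eq_zero_of_g_mul_self hx
  have hu0 := hu.1.ae_eq_zero_of_weakLaplacian hΩ hΩb hG h hL0
  have := hu.2.1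
  rw [modular_congr hu0] at this
  simp only [modular, Pi.zero_apply, hG.G_zero, integral_zero] at this
  linarith

/-- The sign implication between the two functionals is upgraded to an inequality by moving v along
u until its constraint pairing is barely positive. -/
lemma IsConstrainedMinimizer.multiplier_mul_le [NeZero n] (hΩ : IsOpen Ω)
    (hΩb : Bornology.IsBounded Ω) (hG : IsNFunction G g) (h : GrowthCondition G g pm pp)
    (hr : 0 < r) (hu : IsConstrainedMinimizer Ω G r u) (hv : MemW20 Ω G v) :
    ((∫ x in Ω, g (weakLaplacian Ω u x) * weakLaplacian Ω u x) / ∫ x in Ω, g (u x) * u x) *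
        (∫ x in Ω, g (u x) * v x) ≤
      ∫ x in Ω, g (weakLaplacian Ω u x) * weakLaplacian Ω v x := by
  have hLu := hu.1.1.memOrlicz_weakLaplacian hΩ hG h
  have hA : ∀ s : ℝ, _ := fun s =>
    MemW2.integral_g_mul_weakLaplacian_add_mul hΩ hG h hLu hv.1 hu.1.1 s
  have hB : ∀ s : ℝ, _ := fun s => hu.1.1.1.integral_g_mul_add_mul hG h hv.1.1 hu.1.1.1 s
  have hApos := hu.integral_self_pos hΩ hΩb hG h hr
  have hBpos : 0 < ∫ x in Ω, g (u x) * u x := by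
    have := modular_le_integral_g_mul_self hG h hu.1.1.1
    rw [hu.2.1] at this
    exact hr.trans_le this
  have hstep : ∀ s : ℝ, _ := fun s => hu.integral_nonneg hΩ hG h hr.le
    (hv.add_mul hΩ hG h hu.1 s)
  simp only [hA, hB] at hstep
  set a := ∫ x in Ω, g (weakLaplacian Ω u x) * weakLaplacian Ω u x
  set b := ∫ x in Ω, g (u x) * u x
  set a' := ∫ x in Ω, g (weakLaplacian Ω u x) * weakLaplacian Ω v x
  set b' := ∫ x in Ω, g (u x) * v x
  refine le_of_forall_pos_le_add fun ε hε => ?_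
  -- The first term of s cancels B(v); the second leaves B(v + su) = εb/a > 0 and costs exactly ε in
  -- A(v + su).
  have h1 := hstep (-(b' / b) + ε / a) (by
    have e : b' + (-(b' / b) + ε / a) * b = ε / a * b := by field_simp; ring
    rw [e]; positivity)
  have e : a' + (-(b' / b) + ε / a) * a = a' + ε - a / b * b' := by field_simp; ring
  rw [e] at h1
  linarith

end Minimizers

end BiharmonicOrlicz

end

theorem mainTheorem7 {n : ℕ} (hn : 1 ≤ n)
    (Ω : Set (EuclideanSpace ℝ (Fin n))) (hΩ_open : IsOpen Ω) (hΩ_conn : IsConnected Ω)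
    (hΩ_bdd : Bornology.IsBounded Ω)
    (G g : ℝ → ℝ) (hG : BiharmonicOrlicz.IsNFunction G g)
    (pm pp : ℝ) (hgrowth : BiharmonicOrlicz.GrowthCondition G g pm pp)
    (r : ℝ) (hr : 0 < r) (u : EuclideanSpace ℝ (Fin n) → ℝ)
    (hu : BiharmonicOrlicz.IsConstrainedMinimizer Ω G r u) :
    ∃ lam : ℝ, 0 < lam ∧
      BiharmonicOrlicz.IsWeakSolution Ω G g
        (fun _ s => lam * BiharmonicOrlicz.signedDensity g s) u := by
  have : NeZero n := ⟨by omega⟩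
  have hLu := hu.1.1.memOrlicz_weakLaplacian hΩ_open hG hgrowth
  have hApos := hu.integral_self_pos hΩ_open hΩ_bdd hG hgrowth hr
  have hBpos : 0 < ∫ x in Ω, g (u x) * u x := by
    have := BiharmonicOrlicz.modular_le_integral_g_mul_self hG hgrowth hu.1.1.1
    rw [hu.2.1] at this
    exact hr.trans_le this
  refine ⟨_, div_pos hApos hBpos, hu.1, fun v hv => ?_⟩
  simp only [hG.signedDensity_eq, mul_assoc]
  refine ⟨hLu.integrable_g_mul hG hgrowth (hv.1.memOrlicz_weakLaplacian hΩ_open hG hgrowth),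
    (hu.1.1.1.integrable_g_mul hG hgrowth hv.1.1).const_mul _, ?_⟩
  rw [integral_const_mul]
  refine le_antisymm ?_ (hu.multiplier_mul_le hΩ_open hΩ_bdd hG hgrowth hr hv)
  -- v + (-2)v = -v: linearity turns the one-sided inequality into an equality.
  have hneg := hu.multiplier_mul_le hΩ_open hΩ_bdd hG hgrowth hr
    (hv.add_mul hΩ_open hG hgrowth hv (-2))
  rw [BiharmonicOrlicz.MemW2.integral_g_mul_weakLaplacian_add_mul hΩ_open hG hgrowth hLu hv.1 hv.1,
    hu.1.1.1.integral_g_mul_add_mul hG hgrowth hv.1.1 hv.1.1] at hneg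
  linarith
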